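/- All graphs are finite and simple. A \emph{$k$-stack layout} (a book embedding with $k$ pages) of a graph $G$ consists of a linear ordering $v_1,\dots,v_n$ of $V(G)$ and a partition $E_1,\dots,E_k$ of $E(G)$ (parts may be empty) such that no two edges in the same $E_i$ cross, where edges $v_av_b$ and $v_cv_d$ cross if $a<c<b<d$. A graph is a \emph{$k$-stack graph} if it has a $k$-stack layout. A graph $G$ is \emph{$(k,d)$-colourable} if its vertices can be assigned colours from a set of $k$ colours so that every vertex $v$ has at most $d$ neighbours with the same colour as $v$. It is \emph{$(k,d)$-choosable} if for every assignment of a set $L(v)$ of exactly $k$ colours to each vertex $v$, one can choose for each vertex $v$ a colour in $L(v)$ so that every vertex has at most $d$ neighbours with its own colour. The \emph{defective chromatic number} (respectively, \emph{defective choice number}) of a class $\mathcal{C}$ of graphs is the minimum integer $k\ge 0$ for which there exists an integer $d\ge 0$ such that every graph in $\mathcal{C}$ is $(k,d)$-colourable (respectively, $(k,d)$-choosable). \textbf{Theorem.} For every integer $k\ge 0$, the class of $k$-stack graphs has defective chromatic number and defective choice number equal to $k+1$. Moreover, there is a function $d:\mathbb{N}\to\mathbb{N}$ with $d(k)\le 2^{O(k\log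 k)}$, that is, $d(k)\le 2^{Ck\log k}$ for some constant $C$ and all $k\ge 2$, such that for every integer $k\ge 0$ every $k$-stack graph is $(k+1,d(k))$-choosable. -/

import Mathlib

universe u

/-- A class of simple graphs: a property of simple graphs on arbitrary vertex types. -/
abbrev GraphClass : Type (u + 1) := ∀ V : Type u, SimpleGraph V → Prop

/-- The vertex colouring `c` of `G` has defect `d`: every vertex `x` has at most `d` neighbours
with the same colour as `x`. (No adjacent vertices are required to get distinct colours.) -/
def HasDefect {V : Type u} {α : Type*} (G : SimpleGraph V) (c : V → α) (d : ℕ) : Prop :=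
  ∀ x : V, {y : V | G.Adj x y ∧ c y = c x}.encard ≤ d

/-- `G` is `(k, d)`-colourable. -/
def DefectiveColorable {V : Type u} (G : SimpleGraph V) (k d : ℕ) : Prop :=
  ∃ c : V → Fin k, HasDefect G c d

/-- `G` is `(k, d)`-choosable: for every assignment `L` of lists of exactly `k` colours to the
vertices there is a colouring with defect `d` that takes the colour of each vertex from its list. -/
def DefectiveChoosable {V : Type u} (G : SimpleGraph V) (k d : ℕ) : Prop :=
  ∀ (α : Type) (L : V → Finset α), (∀ x, (L x).card = k) →
    ∃ c : V → α, (∀ x, c x ∈ L x) ∧ HasDefect G c d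

/-- `k` is the defective chromatic number of the class `𝒞`: the minimum `k` for which there is
a `d` such that every graph in `𝒞` is `(k, d)`-colourable. -/
def IsDefectiveChromaticNumber (𝒞 : GraphClass.{u}) (k : ℕ) : Prop :=
  IsLeast {j : ℕ | ∃ d : ℕ, ∀ (V : Type u) (G : SimpleGraph V), 𝒞 V G →
    DefectiveColorable G j d} k

/-- `k` is the defective choice number of the class `𝒞`: the minimum `k` for which there is
a `d` such that every graph in `𝒞` is `(k, d)`-choosable. -/
def IsDefectiveChoiceNumber (𝒞 : GraphClass.{u}) (k : ℕ) : Prop :=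
  IsLeast {j : ℕ | ∃ d : ℕ, ∀ (V : Type u) (G : SimpleGraph V), 𝒞 V G →
    DefectiveChoosable G j d} k

/-- A `k`-stack layout (a book embedding with `k` pages) of a finite graph `G`: a linear ordering
`v 0, v 1, …, v (n - 1)` of its vertices and a partition of its edges into `k` (possibly empty)
parts, given by `page`, such that no two edges in the same part cross. The edges `v a v b` and
`v c v d` cross if `a < c < b < d`. -/
structure StackLayout {V : Type u} (G : SimpleGraph V) (k : ℕ) where
  n : ℕ
  v : Fin n ≃ V
  page : G.edgeSet → Fin k
  noncrossing : ∀ (a b c d : Fin n) (hab : G.Adj (v a) (v b)) (hcd : G.Adj (v c) (v d)),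
    a < c → c < b → b < d →
      page ⟨s(v a, v b), G.mem_edgeSet.mpr hab⟩ ≠ page ⟨s(v c, v d), G.mem_edgeSet.mpr hcd⟩

/-- The class of `k`-stack graphs (finite simple graphs with a `k`-stack layout). -/
def stackGraphs (k : ℕ) : GraphClass.{u} :=
  fun _ G => Nonempty (StackLayout G k)

/-! Upper bound: some edge-deletion always makes induction work. If a graph with an edge and `k`
pages has no nonisolated vertex of degree at most `k`, then some edge joins two vertices of degree
at most `4k(4k+1)` (`IsPaging.exists_light`). A vertex of degree at most `k` can be coloured last,
avoiding all its neighbours' colours. The ends of a light edge never have too many neighbours of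
their own colour, so that edge can be dropped. The light edge comes from counting: otherwise light
vertices see only heavy ones, so they number at most `4k` per heavy vertex
(`IsPaging.card_le_of_lt_degree`), too few for the linear edge bound (`IsPaging.sum_degree_le`) to
allow large heavy degrees. The defect is thus even quadratic in `k`.

Lower bound: coning over `d + 1` disjoint copies costs one more page and forces one more colour. -/

/-- An assignment of page numbers below `k` to the edges of a graph on a linearly ordered vertex
set such that no two edges with the same page number cross. -/
structure IsPaging {V : Type*} [LinearOrder V] (G : SimpleGraph V) (k : ℕ)
    (page : Sym2 V → ℕ) : Prop where
  lt : ∀ a b, G.Adj a b → page s(a, b) < k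
  noncrossing : ∀ a b c d, G.Adj a c → G.Adj b d → a < b → b < c → c < d →
    page s(a, c) ≠ page s(b, d)

theorem IsPaging.mono {V : Type*} [LinearOrder V] {G H : SimpleGraph V} {k : ℕ}
    {page : Sym2 V → ℕ} (h : IsPaging G k page) (hHG : H ≤ G) : IsPaging H k page :=
  ⟨fun a b hab => h.lt a b (hHG hab),
    fun a b c d hac hbd => h.noncrossing a b c d (hHG hac) (hHG hbd)⟩

/-! ### Counting edges and finding a light edge -/

section Counting

open Finset

variable {V : Type*} [LinearOrder V] [Fintype V] {G : SimpleGraph V} {k : ℕ}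
  {page : Sym2 V → ℕ}

/-- A paged graph whose edges have both ends in `S` has at most `2 k |S|` edges: each edge is
the longest edge of its page to the right of its left end, or to the left of its right end. -/
theorem IsPaging.card_edges_le [DecidableRel G.Adj] (h : IsPaging G k page) (S : Finset V)
    (hS : ∀ a b, G.Adj a b → a ∈ S) :
    (univ.filter fun e : V × V => G.Adj e.1 e.2 ∧ e.1 < e.2).card ≤ 2 * k * S.card := by
  classical
  set E := univ.filter fun e : V × V => G.Adj e.1 e.2 ∧ e.1 < e.2 with hE
  set P : V × V → Prop := fun e =>
    ∀ c, G.Adj e.1 c → e.1 < c → page s(e.1, c) = page s(e.1, e.2) → c ≤ e.2 with hP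
  have h1 : (E.filter P).card ≤ (range k ×ˢ S).card := by
    refine card_le_card_of_injOn (fun e => (page s(e.1, e.2), e.1)) ?_ ?_
    · rintro ⟨a, b⟩ he
      simp only [hE, coe_filter, mem_filter, mem_univ, true_and, Set.mem_ofPred_eq] at he
      simpa using ⟨h.lt a b he.1.1, hS a b he.1.1⟩
    · rintro ⟨a, b⟩ he ⟨a', b'⟩ he' heq
      simp only [hE, hP, coe_filter, mem_filter, mem_univ, true_and, Set.mem_ofPred_eq] at he he'
      simp only [Prod.mk.injEq] at heq
      obtain ⟨hp, rfl⟩ := heq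
      rw [le_antisymm (he'.2 b he.1.1 he.1.2 hp) (he.2 b' he'.1.1 he'.1.2 hp.symm)]
  have h2 : (E.filter fun e => ¬ P e).card ≤ (range k ×ˢ S).card := by
    refine card_le_card_of_injOn (fun e => (page s(e.1, e.2), e.2)) ?_ ?_
    · rintro ⟨a, b⟩ he
      simp only [hE, coe_filter, mem_filter, mem_univ, true_and, Set.mem_ofPred_eq] at he
      simpa using ⟨h.lt a b he.1.1, hS b a he.1.1.symm⟩
    · have key : ∀ a a' b, (a, b) ∈ E → (a', b) ∈ E → ¬ P (a', b) →
          page s(a, b) = page s(a', b) → a' ≤ a := by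
        intro a a' b ha ha' hn hp
        simp only [hE, hP, mem_filter, mem_univ, true_and] at ha ha' hn
        by_contra hlt
        push Not at hlt hn
        obtain ⟨c, hc, -, hpc, hbc⟩ := hn
        exact h.noncrossing a a' b c ha.1 hc hlt ha'.2 hbc (hp.trans hpc.symm)
      rintro ⟨a, b⟩ he ⟨a', b'⟩ he' heq
      simp only [Prod.mk.injEq] at heq
      obtain ⟨hp, rfl⟩ := heq
      rw [coe_filter] at he he'
      rw [le_antisymm (key a' a b he'.1 he.1 he.2 hp.symm) (key a a' b he.1 he'.1 he'.2 hp)]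
  rw [← card_filter_add_card_filter_not (s := E) P]
  rw [card_product, card_range] at h1 h2
  linarith

/-- Handshaking: each edge is counted at most once from each end. The set `S` keeps isolated
vertices out of the bound. -/
theorem IsPaging.sum_degree_le [DecidableRel G.Adj] (h : IsPaging G k page) (S : Finset V)
    (hS : ∀ a b, G.Adj a b → a ∈ S) (B : Finset V) :
    ∑ x ∈ B, G.degree x ≤ 4 * k * S.card := by
  classical
  set E := univ.filter fun e : V × V => G.Adj e.1 e.2 ∧ e.1 < e.2 with hE
  have h1 : ∑ x ∈ B, G.degree x ≤ (E ∪ E.image Prod.swap).card := by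
    have : ∑ x ∈ B, G.degree x = (B.sigma fun x => G.neighborFinset x).card := by
      simp [card_sigma]
    rw [this]
    refine card_le_card_of_injOn (fun e => (e.1, e.2)) ?_ ?_
    · rintro ⟨a, b⟩ he
      have hab : G.Adj a b := by
        have := (mem_sigma.mp (mem_coe.mp he)).2
        simpa using this
      rw [mem_coe, mem_union]
      rcases lt_or_gt_of_ne hab.ne with hlt | hlt
      · exact Or.inl (by simp [hE, hab, hlt])
      · exact Or.inr (mem_image.mpr ⟨(b, a), by simp [hE, hab.symm, hlt], rfl⟩)
    · rintro ⟨a, b⟩ - ⟨a', b'⟩ - heq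
      simp only [Prod.mk.injEq] at heq
      obtain ⟨rfl, rfl⟩ := heq
      rfl
  have h2 := card_union_le E (E.image Prod.swap)
  have h3 : (E.image Prod.swap).card ≤ E.card := card_image_le
  have h4 := h.card_edges_le S hS
  rw [← hE] at h4
  linarith

/-- If every vertex of `A` has more than `k` neighbours, all of them in a set `B` disjoint
from `A`, then `|A| ≤ 4 k |B|`: every vertex of `A` has two neighbours on the same page. -/
theorem IsPaging.card_le_of_lt_degree [DecidableRel G.Adj] (h : IsPaging G k page)
    (A B : Finset V) (hAB : Disjoint A B) (hA : ∀ a ∈ A, ∀ b, G.Adj a b → b ∈ B)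
    (hdeg : ∀ a ∈ A, k < G.degree a) : A.card ≤ 4 * k * B.card := by
  classical
  have hex : ∀ a, ∃ u v, a ∈ A → G.Adj a u ∧ G.Adj a v ∧ u < v ∧
      page s(a, u) = page s(a, v) := by
    intro a
    by_cases ha : a ∈ A
    swap
    · exact ⟨a, a, fun h => absurd h ha⟩
    obtain ⟨u, hu, v, hv, hne, hp⟩ := exists_ne_map_eq_of_card_lt_of_maps_to
      (s := G.neighborFinset a) (t := range k) (f := fun u => page s(a, u))
      (by simpa using hdeg a ha) (by
        intro u hu
        simpa using h.lt a u (by simpa using hu))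
    rw [SimpleGraph.mem_neighborFinset] at hu hv
    rcases lt_or_gt_of_ne hne with hlt | hlt
    · exact ⟨u, v, fun _ => ⟨hu, hv, hlt, hp⟩⟩
    · exact ⟨v, u, fun _ => ⟨hv, hu, hlt, hp.symm⟩⟩
  choose u v huv using hex
  have hu : ∀ a ∈ A, G.Adj a (u a) := fun a ha => (huv a ha).1
  have hv : ∀ a ∈ A, G.Adj a (v a) := fun a ha => (huv a ha).2.1
  have hlt : ∀ a ∈ A, u a < v a := fun a ha => (huv a ha).2.2.1
  have hp : ∀ a ∈ A, page s(a, u a) = page s(a, v a) := fun a ha => (huv a ha).2.2.2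
  set q : V → ℕ := fun a => page s(a, u a) with hq
  have hneAB : ∀ a ∈ A, ∀ b ∈ A, a ≠ u b ∧ a ≠ v b := fun a ha b hb =>
    ⟨disjoint_iff_ne.mp hAB a ha _ (hA b hb _ (hu b hb)),
      disjoint_iff_ne.mp hAB a ha _ (hA b hb _ (hv b hb))⟩
  have crossing : ∀ a b c d, G.Adj a c → G.Adj b d → page s(a, c) = page s(b, d) → a < b →
      b < c → c < d → False := fun a b c d hac hbd e h1 h2 h3 =>
    h.noncrossing a b c d hac hbd h1 h2 h3 e
  have count : ∀ (Q : V → Prop) [DecidablePred Q] (w : V → V), (∀ a ∈ A, w a ∈ B) →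
      (∀ a ∈ A, ∀ b ∈ A, Q a → Q b → q a = q b → w a = w b → ¬ a < b) →
      (A.filter Q).card ≤ k * B.card := by
    intro Q _ w hw hinj
    have hcard : (range k ×ˢ B).card = k * B.card := by rw [card_product, card_range]
    rw [← hcard]
    refine card_le_card_of_injOn (fun a => (q a, w a)) ?_ ?_
    · intro a ha
      have ha := (mem_filter.mp (mem_coe.mp ha)).1
      simpa using ⟨h.lt _ _ (hu a ha), hw a ha⟩
    · intro a ha b hb heq
      have ha := mem_filter.mp (mem_coe.mp ha)
      have hb := mem_filter.mp (mem_coe.mp hb)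
      simp only [Prod.mk.injEq] at heq
      exact le_antisymm
        (not_lt.mp (hinj b hb.1 a ha.1 hb.2 ha.2 heq.1.symm heq.2.symm))
        (not_lt.mp (hinj a ha.1 b hb.1 ha.2 hb.2 heq.1 heq.2))
  have huB : ∀ a ∈ A, u a ∈ B := fun a ha => hA a ha _ (hu a ha)
  have hvB : ∀ a ∈ A, v a ∈ B := fun a ha => hA a ha _ (hv a ha)
  -- For `u a < a < v a`, `F` selects the leftmost such vertex for each pair of page and right
  -- neighbour.
  set F : V → Prop := fun a => ∀ c ∈ A, u c < c → c < v c → q c = q a → v c = v a → a ≤ c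
    with hF
  have c1 := count (fun a => a < u a) u huB (by
    intro a ha b hb ha' hb' e e' hab
    refine crossing a b (u a) (v b) (hu a ha) (hv b hb) ?_ hab (e' ▸ hb') (e' ▸ hlt b hb)
    rw [← hp b hb]; exact e)
  have c2 := count (fun a => v a < a) v hvB (by
    intro a ha b hb ha' hb' e e' hab
    refine crossing (u a) (v b) a b (hu a ha).symm (hv b hb).symm ?_ (e' ▸ hlt a ha)
      (e' ▸ ha') hab
    rw [Sym2.eq_swap, Sym2.eq_swap (a := v b), ← hp b hb]; exact e)
  have c3 := count (fun a => u a < a ∧ a < v a ∧ F a) v hvB (by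
    intro a ha b hb ha' hb' e e' hab
    exact absurd (hb'.2.2 a ha ha'.1 ha'.2.1 e e') (not_le.mpr hab))
  -- Let `a < b` share page and `u`, and let `c < a` share page and `v` with `a`. Noncrossing puts
  -- `c` left of `u a` and `b` right of `v a`, and then the edges from `c` to `v` and from `u` to
  -- `b` cross.
  have c4 := count (fun a => u a < a ∧ a < v a ∧ ¬ F a) u huB (by
    intro a ha b hb ha' hb' e e' hab
    obtain ⟨h1, h2, h3⟩ := ha'
    simp only [hF] at h3
    push Not at h3
    obtain ⟨c, hc, h4, h5, h6, h7, h8⟩ := h3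
    have pu : ∀ x ∈ A, page s(u x, x) = q x := fun x _ => by rw [Sym2.eq_swap]
    have pv : ∀ x ∈ A, page s(x, v x) = q x := fun x hx => (hp x hx).symm
    have hcu : c < u a := by
      refine lt_of_le_of_ne (not_lt.mp fun hlt' => ?_) (hneAB c hc a ha).1
      exact crossing (u a) c a (v c) (hu a ha).symm (hv c hc)
        (by rw [pu a ha, pv c hc, h6]) hlt' h8 (h7 ▸ h2)
    have hvb : v a < b := by
      refine lt_of_le_of_ne (not_lt.mp fun hlt' => ?_) (hneAB b hb a ha).2.symm
      exact crossing (u b) a b (v a) (hu b hb).symm (hv a ha)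
        (by rw [pu b hb, pv a ha, e]) (e' ▸ h1) hab hlt'
    exact crossing c (u b) (v c) b (hv c hc) (hu b hb).symm
      (by rw [pu b hb, pv c hc, h6, e]) (e' ▸ hcu) (h7 ▸ e' ▸ hlt a ha) (h7 ▸ hvb))
  have hcover : A ⊆ A.filter (fun a => a < u a) ∪ A.filter (fun a => v a < a) ∪
      (A.filter (fun a => u a < a ∧ a < v a ∧ F a) ∪
        A.filter (fun a => u a < a ∧ a < v a ∧ ¬ F a)) := by
    intro a ha
    have := (hneAB a ha a ha)
    simp only [mem_union, mem_filter, ha, true_and]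
    rcases lt_or_gt_of_ne this.1 with h1 | h1
    · exact Or.inl (Or.inl h1)
    rcases lt_or_gt_of_ne this.2 with h2 | h2
    · by_cases h3 : F a
      · exact Or.inr (Or.inl ⟨h1, h2, h3⟩)
      · exact Or.inr (Or.inr ⟨h1, h2, h3⟩)
    · exact Or.inl (Or.inr h2)
  have := (card_le_card hcover).trans ((card_union_le _ _).trans
    (add_le_add ((card_union_le _ _).trans (add_le_add c1 c2))
      ((card_union_le _ _).trans (add_le_add c3 c4))))
  linarith

/-- A nonempty `k`-page graph has a nonisolated vertex of degree at most `k`, or an edge with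
both ends of degree at most `4 k (4 k + 1)`. -/
theorem IsPaging.exists_light [DecidableRel G.Adj] (h : IsPaging G k page) (hG : G ≠ ⊥) :
    (∃ x, 0 < G.degree x ∧ G.degree x ≤ k) ∨
      ∃ x y, G.Adj x y ∧ G.degree x ≤ 4 * k * (4 * k + 1) ∧
        G.degree y ≤ 4 * k * (4 * k + 1) := by
  classical
  by_contra! hcon
  obtain ⟨hlow, hlight⟩ := hcon
  set l := 4 * k * (4 * k + 1) with hl
  set A := univ.filter fun x => 0 < G.degree x ∧ G.degree x ≤ l with hAdef
  set B := univ.filter fun x => l < G.degree x with hBdef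
  have hpos : ∀ a b, G.Adj a b → 0 < G.degree a := fun a b hab =>
    (G.degree_pos_iff_exists_adj a).mpr ⟨b, hab⟩
  have hAB : Disjoint A B := by
    rw [disjoint_left]
    intro x hx hx'
    simp only [hAdef, hBdef, mem_filter, mem_univ, true_and] at hx hx'
    omega
  have h1 : A.card ≤ 4 * k * B.card := by
    refine h.card_le_of_lt_degree A B hAB ?_ ?_
    · intro a ha b hab
      simp only [hAdef, hBdef, mem_filter, mem_univ, true_and] at ha ⊢
      exact hlight a b hab ha.2
    · intro a ha
      simp only [hAdef, mem_filter, mem_univ, true_and] at ha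
      exact hlow a ha.1
  have h2 : ∑ x ∈ B, G.degree x ≤ 4 * k * (A ∪ B).card := by
    refine h.sum_degree_le _ ?_ B
    intro a b hab
    have := hpos a b hab
    simp only [hAdef, hBdef, mem_union, mem_filter, mem_univ, true_and]
    omega
  have h3 : B.card * (l + 1) ≤ ∑ x ∈ B, G.degree x := by
    rw [← smul_eq_mul]
    refine card_nsmul_le_sum B _ _ fun x hx => ?_
    simpa [hBdef] using hx
  -- Chaining the bounds gives `(l + 1)|B| ≤ 4k(4k + 1)|B| = l|B|`, which dictates the choice of
  -- `l`.
  have hB : B.card = 0 := by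
    have h4 := card_union_le A B
    have h5 : 4 * k * (A ∪ B).card ≤ 4 * k * (4 * k * B.card + B.card) :=
      Nat.mul_le_mul_left _ (by linarith)
    have h6 : 4 * k * (4 * k * B.card + B.card) = B.card * l := by rw [hl]; ring
    have h7 : B.card * (l + 1) = B.card * l + B.card := by ring
    omega
  have hA : A.card = 0 := by simpa [hB] using h1
  obtain ⟨a, b, hab⟩ := SimpleGraph.ne_bot_iff_exists_adj.mp hG
  have := hpos a b hab
  rw [card_eq_zero, hAdef, filter_eq_empty_iff] at hA
  rw [card_eq_zero, hBdef, filter_eq_empty_iff] at hB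
  have hA := hA (mem_univ a)
  have hB := hB (mem_univ a)
  omega

end Counting

/-! ### Upper bound: choosability by edge deletion -/

theorem IsPaging.defectiveChoosable {V : Type u} [LinearOrder V] [Finite V] {G : SimpleGraph V}
    {k : ℕ} {page : Sym2 V → ℕ} (h : IsPaging G k page) :
    DefectiveChoosable G (k + 1) (4 * k * (4 * k + 1)) := by
  classical
  have _ := Fintype.ofFinite V
  intro α L hL
  -- Only edges are deleted, so the vertex set, its order, the lists and the paging stay fixed.
  induction G using WellFoundedLT.induction with
  | ind G ih =>
  by_cases hG : G = ⊥
  · subst hG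
    choose c hc using fun x => Finset.card_pos.mp (by rw [hL x]; omega : 0 < (L x).card)
    exact ⟨c, hc, fun x => by simp⟩
  rcases h.exists_light hG with ⟨x, hx0, hxk⟩ | ⟨x, y, hxy, hx, hy⟩
  · obtain ⟨z, hz⟩ := (G.degree_pos_iff_exists_adj x).mp hx0
    have hadj : ∀ a b, (G.deleteIncidenceSet x).Adj a b ↔ G.Adj a b ∧ a ≠ x ∧ b ≠ x := fun a b =>
      SimpleGraph.deleteIncidenceSet_adj
    have hle : G.deleteIncidenceSet x ≤ G := fun a b hab => ((hadj a b).mp hab).1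
    have hlt : G.deleteIncidenceSet x < G := lt_of_le_not_ge hle fun hge =>
      ((hadj x z).mp (hge hz)).2.1 rfl
    obtain ⟨c, hc, hcd⟩ := ih _ hlt (h.mono hle)
    obtain ⟨t, htL, ht⟩ : ∃ t ∈ L x, t ∉ (G.neighborFinset x).image c := by
      refine Finset.exists_mem_notMem_of_card_lt_card ?_
      have := (Finset.card_image_le (s := G.neighborFinset x) (f := c))
      rw [SimpleGraph.card_neighborFinset_eq_degree] at this
      rw [hL x]
      omega
    have htn : ∀ b, G.Adj x b → c b ≠ t := fun b hb e =>
      ht (Finset.mem_image.mpr ⟨b, by simpa using hb, e⟩)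
    refine ⟨Function.update c x t, ?_, ?_⟩
    · intro y
      by_cases hy : y = x
      · subst hy; simpa using htL
      · simpa [hy] using hc y
    · intro y
      by_cases hy : y = x
      · subst hy
        have : {b : V | G.Adj y b ∧ Function.update c y t b = Function.update c y t y} = ∅ := by
          ext b
          simp only [Function.update_self, Set.mem_ofPred_eq, Set.mem_empty_iff_false, iff_false]
          rintro ⟨hb, e⟩
          rw [Function.update_of_ne hb.ne'] at e
          exact htn b hb e
        rw [this]; simp
      · refine le_trans (Set.encard_le_encard ?_) (hcd y)
        rintro b ⟨hb, e⟩
        rw [Function.update_of_ne hy] at e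
        by_cases hbx : b = x
        · subst hbx
          rw [Function.update_self] at e
          exact absurd e.symm (htn y hb.symm)
        · rw [Function.update_of_ne hbx] at e
          exact ⟨(hadj y b).mpr ⟨hb, hy, hbx⟩, e⟩
  -- The colouring without the edge `xy` is kept: `x` and `y` are safe by degree alone, and other
  -- vertices lose no neighbour.
  · have hlt : G.deleteEdges {s(x, y)} < G := lt_of_le_not_ge (G.deleteEdges_le _) fun hge => by
      have := hge hxy
      simp [SimpleGraph.deleteEdges_adj] at this
    obtain ⟨c, hc, hcd⟩ := ih _ hlt (h.mono hlt.le)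
    have hdeg : ∀ z, G.degree z ≤ 4 * k * (4 * k + 1) →
        {b : V | G.Adj z b ∧ c b = c z}.encard ≤ (4 * k * (4 * k + 1) : ℕ) := by
      intro z hz
      calc {b : V | G.Adj z b ∧ c b = c z}.encard
          ≤ (G.neighborFinset z : Set V).encard :=
            Set.encard_le_encard fun b hb => by simpa using hb.1
        _ = G.degree z := by
            rw [Set.encard_coe_eq_coe_finsetCard, SimpleGraph.card_neighborFinset_eq_degree]
        _ ≤ _ := by exact_mod_cast hz
    refine ⟨c, hc, fun z => ?_⟩
    by_cases hzx : z = x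
    · exact hdeg z (hzx ▸ hx)
    by_cases hzy : z = y
    · exact hdeg z (hzy ▸ hy)
    refine le_trans (Set.encard_le_encard ?_) (hcd z)
    rintro b ⟨hb, e⟩
    refine ⟨?_, e⟩
    simp [SimpleGraph.deleteEdges_adj, hb, hzx, hzy]

theorem StackLayout.defectiveChoosable {V : Type u} {G : SimpleGraph V} {k : ℕ}
    (L : StackLayout G k) : DefectiveChoosable G (k + 1) (4 * k * (4 * k + 1)) := by
  classical
  let _ : LinearOrder V := LinearOrder.lift' L.v.symm L.v.symm.injective
  have : Finite V := Finite.of_equiv _ L.v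
  have hpaging : IsPaging G k
      (fun e => if he : e ∈ G.edgeSet then (L.page ⟨e, he⟩ : ℕ) else 0) := by
    constructor
    · intro a b hab
      rw [dif_pos (G.mem_edgeSet.mpr hab)]
      exact Fin.is_lt _
    · intro a b c d hac hbd h1 h2 h3 e
      rw [dif_pos (G.mem_edgeSet.mpr hac), dif_pos (G.mem_edgeSet.mpr hbd)] at e
      have key := L.noncrossing (L.v.symm a) (L.v.symm c) (L.v.symm b) (L.v.symm d)
        (by simpa using hac) (by simpa using hbd) h1 h2 h3
      apply key
      simp only [Equiv.apply_symm_apply]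
      exact Fin.ext e
  exact hpaging.defectiveChoosable

/-! ### Lower bound: iterated cones -/

/-- The join of a new vertex with `m` disjoint copies of `G`. -/
def coneCopies {V : Type u} (G : SimpleGraph V) (m : ℕ) : SimpleGraph (Option (Fin m × V)) where
  Adj
    | none, none => False
    | none, some _ => True
    | some _, none => True
    | some a, some b => a.1 = b.1 ∧ G.Adj a.2 b.2
  symm := ⟨by
    rintro (_ | a) (_ | b) h
    · exact h
    · trivial
    · trivial
    · exact ⟨h.1.symm, h.2.symm⟩⟩
  loopless := ⟨by
    rintro (_ | a) h
    · exact h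
    · exact G.loopless.irrefl _ h.2⟩

/-- If every copy used the apex colour, the apex would have `d + 1` neighbours of its colour. So
some copy avoids it and is coloured with the remaining `k` colours. -/
theorem coneCopies_not_defectiveColorable {V : Type u} {G : SimpleGraph V} {k d : ℕ}
    (h : ¬ DefectiveColorable G k d) :
    ¬ DefectiveColorable (coneCopies G (d + 1)) (k + 1) d := by
  rintro ⟨c, hc⟩
  have hex : ∀ i : Fin (d + 1), ∃ x, c (some (i, x)) = c none := by
    intro i
    by_contra! hne
    apply h
    choose f hf using fun x => Fin.exists_succAbove_eq (hne x)
    refine ⟨f, fun x => ?_⟩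
    refine le_trans ?_ (hc (some (i, x)))
    have hinj : Function.Injective fun y : V => (some (i, y) : Option (Fin (d + 1) × V)) := by
      intro y z hyz
      simpa using hyz
    rw [← hinj.encard_image]
    refine Set.encard_le_encard ?_
    rintro _ ⟨y, ⟨hy, e⟩, rfl⟩
    refine ⟨⟨rfl, hy⟩, ?_⟩
    rw [← hf x, ← hf y, e]
  choose x hx using hex
  have hinj : Function.Injective fun i : Fin (d + 1) =>
      (some (i, x i) : Option (Fin (d + 1) × V)) := by
    intro i j hij
    have := Option.some.inj hij
    exact congrArg Prod.fst this
  have h1 : ((d + 1 : ℕ) : ℕ∞) ≤ d := by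
    calc ((d + 1 : ℕ) : ℕ∞) = (Set.univ : Set (Fin (d + 1))).encard := by simp
      _ = (Set.range fun i : Fin (d + 1) =>
          (some (i, x i) : Option (Fin (d + 1) × V))).encard := by
          rw [← Set.image_univ, hinj.encard_image]
      _ ≤ _ := Set.encard_le_encard (by
          rintro _ ⟨i, rfl⟩
          exact ⟨trivial, hx i⟩)
      _ ≤ d := hc none
  have := ENat.natCast_le_natCast.mp h1
  omega

theorem stackGraphs_of_linearOrder {V : Type u} [LinearOrder V] [Fintype V] {G : SimpleGraph V}
    {k : ℕ} {page : Sym2 V → ℕ} (h : IsPaging G k page) : stackGraphs k V G := by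
  let e : Fin (Fintype.card V) ≃o V := Fintype.orderIsoFinOfCardEq V rfl
  refine ⟨⟨_, e.toEquiv, fun f => ⟨page f, ?_⟩, ?_⟩⟩
  · obtain ⟨f, hf⟩ := f
    induction f with
    | _ a b => exact h.lt a b hf
  · intro a b c d hab hcd h1 h2 h3 heq
    exact h.noncrossing _ _ _ _ hab hcd (e.lt_iff_lt.mpr h1) (e.lt_iff_lt.mpr h2)
      (e.lt_iff_lt.mpr h3) (congrArg Fin.val heq)

/-- The apex comes first and its edges, which share an end, get the new page `k`; the copies occupy
consecutive blocks and reuse the old pages. -/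
theorem IsPaging.exists_coneCopies {V : Type u} [LinearOrder V] [Inhabited V]
    {G : SimpleGraph V} {k : ℕ} {page : Sym2 V → ℕ} (h : IsPaging G k page) (m : ℕ) :
    ∃ (_ : LinearOrder (Option (Fin m × V))) (page' : Sym2 (Option (Fin m × V)) → ℕ),
      IsPaging (coneCopies G m) (k + 1) page' := by
  classical
  let f : Option (Fin m × V) → WithBot (Fin m ×ₗ V) := fun o => o.map toLex
  have hf : Function.Injective f := Option.map_injective toLex.injective
  let ord : LinearOrder (Option (Fin m × V)) := LinearOrder.lift' f hf
  -- The default at the apex is harmless: edges at the apex get page `k` without consulting `g`.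
  let g : Option (Fin m × V) → V := fun o => (o.map Prod.snd).getD default
  have hbot : ∀ a b : Option (Fin m × V), f a < f b → b ≠ none := by
    rintro a _ hab rfl
    exact not_lt_bot hab
  have hlex : ∀ a b : Fin m × V, f (some a) < f (some b) →
      a.1 < b.1 ∨ a.1 = b.1 ∧ a.2 < b.2 := by
    intro a b hab
    have : toLex a < toLex b := WithBot.coe_lt_coe.mp hab
    simpa [Prod.Lex.lt_iff] using this
  refine ⟨ord, fun e => if none ∈ e then k else page (e.map g), ?_, ?_⟩
  · intro a b hab
    split_ifs with hn
    · exact Nat.lt_succ_self k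
    · rcases a with _ | a
      · exact absurd (Sym2.mem_mk_left _ _) hn
      rcases b with _ | b
      · exact absurd (Sym2.mem_mk_right _ _) hn
      exact (h.lt _ _ hab.2).trans (Nat.lt_succ_self k)
  · intro a b c d hac hbd h1 h2 h3
    rcases b with _ | b
    · exact absurd rfl (hbot _ _ h1)
    rcases c with _ | c
    · exact absurd rfl (hbot _ _ h2)
    rcases d with _ | d
    · exact absurd rfl (hbot _ _ h3)
    have hbd' := h.lt _ _ hbd.2
    rcases a with _ | a
    · simpa [g] using hbd'.ne'
    have e1 : a.1 = c.1 := hac.1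
    have e2 : b.1 = d.1 := hbd.1
    have key := h.noncrossing a.2 b.2 c.2 d.2 hac.2 hbd.2
    have l1 := hlex _ _ h1
    have l2 := hlex _ _ h2
    have l3 := hlex _ _ h3
    have hab : a.1 = b.1 := by
      apply le_antisymm
      · rcases l1 with h | h
        exacts [h.le, h.1.le]
      · rw [e1]
        rcases l2 with h | h
        exacts [h.le, h.1.le]
    have hbc : b.1 = c.1 := hab.symm.trans e1
    have hcd : c.1 = d.1 := hbc.symm.trans e2
    simpa [g] using key (l1.resolve_left hab.not_lt).2 (l2.resolve_left hbc.not_lt).2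
      (l3.resolve_left hcd.not_lt).2

theorem exists_isPaging_not_defectiveColorable (k d : ℕ) :
    ∃ (V : Type u) (_ : LinearOrder V) (_ : Fintype V) (_ : Inhabited V) (G : SimpleGraph V)
      (page : Sym2 V → ℕ), IsPaging G k page ∧ ¬ DefectiveColorable G k d := by
  induction k with
  | zero =>
    refine ⟨PUnit, inferInstance, inferInstance, inferInstance, ⊥, fun _ => 0,
      ⟨fun _ _ h => h.elim, fun _ _ _ _ h => h.elim⟩, ?_⟩
    rintro ⟨c, -⟩
    exact (c PUnit.unit).elim0
  | succ k ih =>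
    obtain ⟨V, _, _, _, G, page, h, hn⟩ := ih
    obtain ⟨ord, page', h'⟩ := h.exists_coneCopies (d + 1)
    exact ⟨Option (Fin (d + 1) × V), ord, inferInstance, inferInstance, coneCopies G (d + 1),
      page', h', coneCopies_not_defectiveColorable hn⟩

theorem DefectiveColorable.mono {V : Type u} {G : SimpleGraph V} {j k d : ℕ} (hjk : j ≤ k)
    (h : DefectiveColorable G j d) : DefectiveColorable G k d := by
  obtain ⟨c, hc⟩ := h
  refine ⟨fun x => Fin.castLE hjk (c x), fun x => ?_⟩
  simpa only [(Fin.castLE_injective hjk).eq_iff] using hc x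

theorem DefectiveChoosable.defectiveColorable {V : Type u} {G : SimpleGraph V} {k d : ℕ}
    (h : DefectiveChoosable G k d) : DefectiveColorable G k d := by
  obtain ⟨c, -, hc⟩ := h (Fin k) (fun _ => Finset.univ) (fun _ => by simp)
  exact ⟨c, hc⟩

theorem lt_of_stackGraphs_defectiveColorable {k j d : ℕ}
    (h : ∀ (V : Type u) (G : SimpleGraph V), stackGraphs k V G → DefectiveColorable G j d) :
    k < j := by
  by_contra! hjk
  obtain ⟨V, _, _, _, G, page, hG, hn⟩ := exists_isPaging_not_defectiveColorable.{u} k d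
  exact hn ((h V G (stackGraphs_of_linearOrder hG)).mono hjk)

/-! ### Size of the defect and conclusion -/

theorem stackGraphs_defect_le_two_rpow (k : ℕ) (hk : 2 ≤ k) :
    ((4 * k * (4 * k + 1) : ℕ) : ℝ) ≤ (2 : ℝ) ^ (20 * ((k : ℝ) * Real.log (k : ℝ))) := by
  have hpow : 4 * k * (4 * k + 1) ≤ 2 ^ (10 * k) := by
    have h1 : k ≤ 2 ^ k := Nat.lt_two_pow_self.le
    have h2 : 2 ^ 2 ≤ 2 ^ k := Nat.pow_le_pow_right (by norm_num) hk
    calc 4 * k * (4 * k + 1) ≤ 2 ^ k * 2 ^ k * (2 ^ k * 2 ^ k + 2 ^ k * 2 ^ k) := by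
          gcongr
          · omega
          · omega
          · nlinarith
      _ = 2 ^ (4 * k + 1) := by ring
      _ ≤ 2 ^ (10 * k) := Nat.pow_le_pow_right (by norm_num) (by omega)
  -- The factor `20` is `10 / (1/2)`, converting the exponent `10k` to `k log k` with the natural
  -- logarithm.
  have hlog : (1 : ℝ) / 2 ≤ Real.log k := by
    have h2 : Real.log 2 ≤ Real.log k := Real.log_le_log (by norm_num) (by exact_mod_cast hk)
    linarith [Real.log_two_gt_d9]
  calc ((4 * k * (4 * k + 1) : ℕ) : ℝ) ≤ ((2 ^ (10 * k) : ℕ) : ℝ) := by exact_mod_cast hpow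
    _ = (2 : ℝ) ^ ((10 * k : ℕ) : ℝ) := by rw [Real.rpow_natCast]; push_cast; rfl
    _ ≤ _ := by
      apply Real.rpow_le_rpow_of_exponent_le (by norm_num)
      push_cast
      have := mul_le_mul_of_nonneg_left hlog (Nat.cast_nonneg (α := ℝ) k)
      linarith

theorem mainTheorem6 :
    (∀ k : ℕ, IsDefectiveChromaticNumber (stackGraphs.{u} k) (k + 1) ∧
      IsDefectiveChoiceNumber (stackGraphs.{u} k) (k + 1)) ∧
    ∃ d : ℕ → ℕ,
      (∃ C : ℝ, ∀ k : ℕ, 2 ≤ k → (d k : ℝ) ≤ (2 : ℝ) ^ (C * ((k : ℝ) * Real.log (k : ℝ)))) ∧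
      ∀ (k : ℕ) (V : Type u) (G : SimpleGraph V), stackGraphs.{u} k V G →
        DefectiveChoosable G (k + 1) (d k) := by
  have upper : ∀ (k : ℕ) (V : Type u) (G : SimpleGraph V), stackGraphs.{u} k V G →
      DefectiveChoosable G (k + 1) (4 * k * (4 * k + 1)) :=
    fun k V G ⟨L⟩ => L.defectiveChoosable
  refine ⟨fun k => ⟨⟨⟨_, fun V G h => (upper k V G h).defectiveColorable⟩, ?_⟩,
    ⟨⟨_, upper k⟩, ?_⟩⟩, fun k => 4 * k * (4 * k + 1),
    ⟨20, stackGraphs_defect_le_two_rpow⟩, upper⟩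
  · rintro j ⟨d, hd⟩
    exact lt_of_stackGraphs_defectiveColorable hd
  · rintro j ⟨d, hd⟩
    exact lt_of_stackGraphs_defectiveColorable fun V G h => (hd V G h).defectiveColorable
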